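/- Let $L$ be a lattice of rank $n\ge 1$ with $L_{\mathbb R}=L\otimes\mathbb R$. A simplicial multi-fan $\Delta=(\Sigma,C,w^\pm)$ of dimension $n$ in $L$ consists of: a finite simplicial complex $\Sigma$ (including the empty simplex), where $\Sigma^{(k)}$ denotes the set of simplices with $k$ vertices, such that every simplex has at most $n$ vertices and $\Sigma^{(n)}\neq\emptyset$; a map $C$ assigning to each $I\in\Sigma^{(k)}$ a $k$-dimensional rational simplicial cone $C(I)\subset L_{\mathbb R}$, such that $J\mapsto C(J)$ is an isomorphism from the poset of faces of $I$ to that of $C(I)$; and maps $w^\pm:\Sigma^{(n)}\to\mathbb Z_{\ge 0}$. Put $w=w^+-w^-$. For $K\in\Sigma$ let $\Delta_K$ be the projected multi-fan: its simplices are the $J\in\Sigma$ with $J\supseteq K$, its cones $C_K(J)$ are the images of the $C(J)$ in $L_{\mathbb R}/\operatorname{span} C(K)$, and its weights are the restrictions of $w^\pm$. Call $\Delta$ complete if for every $K\in\Sigma$ the integer $\sum_{I\in\Sigma^{(n)},\,I\supseteq K,\,v\in C_K(I)}w(I)$ is the same for all generic $v\in L_{\mathbb R}/\operatorname{span}C(K)$,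 that is, all $v$ that lie in no linear subspace spanned by a cone $C_K(J)$ with $|J|<n$. A set of edge vectors of $\Delta$ is a family $\mathcal V=\{v_i\in L\}_{i\in\Sigma^{(1)}}$ such that $v_i$ generates the cone $C(i)$ (it need not be primitive). For $I\in\Sigma^{(n)}$ let $L_{I,\mathcal V}\subset L$ be the sublattice generated by $\{v_i\}_{i\in I}$, let $H_I=L/L_{I,\mathcal V}$ (a finite group), let $\{u_i^I\}_{i\in I}\subset L_{\mathbb R}^*$ be the basis dual to $\{v_i\}_{i\in I}$, and for $h\in H_I$ with representative $v(h)\in L$ let $\chi_I(u_i^I,h)=e^{2\pi\sqrt{-1}\langle u_i^I,v(h)\rangle}$. Let $L_{\mathcal V}=\bigcap_{I\in\Sigma^{(n)}}L_{I,\mathcal V}$. Condition (P) is: $L_{I,\mathcal V}=L_{\mathcal V}$ for all $I\in\Sigma^{(n)}$. Let $H_T^2(\Delta)$ be the group of linear forms in the face ring $\mathbb Z[x_i\mid i\in\Sigma^{(1)}]/(\prod_{i\in J}x_i\mid J\notin\Sigma)$, and map $L^*=\operatorname{Hom}(L,\mathbb Z)$ to $H^2_T(\Delta)$ by $u\mapsto\sum_i\langle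 u,v_i\rangle x_i$. The first Chern class $c_1(\Delta,\mathcal V)$ is the class of $\sum_i x_i$ in the quotient of $H_T^2(\Delta)$ by the image of $L^*$. For $y\in\mathbb C$ the equivariant $T_y$-genus of $(\Delta,\mathcal V)$ is $$T_y(\Delta,\mathcal V)=\sum_{I\in\Sigma^{(n)}}\frac{w(I)}{|H_I|}\sum_{h\in H_I}\prod_{i\in I}\frac{1+y\,\chi_I(u_i^I,h)^{-1}t^{-u_i^I}}{1-\chi_I(u_i^I,h)^{-1}t^{-u_i^I}},$$ an element of the field of fractions of the group ring $\mathbb C[L_{\mathbb R}^*]$, whose basis elements are written $t^u$, $u\in L_{\mathbb R}^*$. For complete $\Delta$, the $T_y$-genus $T_y[\Delta]$ is the common constant value of $T_y(\Delta,\mathcal V)$ for all sets $\mathcal V$ of edge vectors. Theorem. Let $\Delta$ be a complete simplicial multi-fan of dimension $n\ge1$ which admits a set of edge vectors $\mathcal V$ satisfying (P), and let $N>1$ be an integer such that $c_1(\Delta,\mathcal V)$ is divisible by $N$. Then for every $y\in\mathbb C$ with $(-y)^N=1$ and $-y\ne1$ one has $T_y[\Delta]=0$; that is, $T_y(\Delta,\mathcal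 V')=0$ for every set $\mathcal V'$ of edge vectors of $\Delta$. -/

import Mathlib

open scoped TensorProduct

noncomputable section

/-- The real vector space `L_ℝ = L ⊗ ℝ` of a lattice `L`. -/
abbrev RealSpace (L : Type*) [AddCommGroup L] : Type _ := ℝ ⊗[ℤ] L

/-- The canonical map `L → L_ℝ`. -/
def toRealSpace (L : Type*) [AddCommGroup L] : L →ₗ[ℤ] RealSpace L :=
  TensorProduct.mk ℤ ℝ L 1

/-- An `n`-dimensional simplicial multi-fan `Δ = (Σ, C, w^±)` in the lattice `L` of rank `n`,
where `Σ` is an augmented (i.e. containing the empty simplex) simplicial complex with vertex set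
`Σ⁽¹⁾ = ι`. Here `Σ⁽ᵏ⁾` is the set of simplices with `k` vertices. Only the values of `cone` on
simplices and the values of `wPos`, `wNeg` on simplices with `n` vertices matter. -/
structure SimplicialMultiFan (ι : Type*) (L : Type*) [AddCommGroup L] where
  simplices : Finset (Finset ι)
  empty_mem : ∅ ∈ simplices
  singleton_mem : ∀ i : ι, {i} ∈ simplices
  down_closed : ∀ I ∈ simplices, ∀ J ⊆ I, J ∈ simplices
  card_le : ∀ I ∈ simplices, I.card ≤ Module.finrank ℤ L
  exists_card_eq : ∃ I ∈ simplices, I.card = Module.finrank ℤ L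
  cone : Finset ι → PointedCone ℝ (RealSpace L)
  /-- `C(I)` is a rational simplicial cone of dimension `|I|`, and `J ↦ C(J)` is the isomorphism
  from the faces of `I` to the faces of `C(I)`: the faces of the cone over linearly independent
  vectors are the cones over the subfamilies. -/
  cone_simplicial : ∀ I ∈ simplices, ∃ a : ι → L,
    LinearIndependent ℝ (fun i : I => toRealSpace L (a i)) ∧
    ∀ J ⊆ I, cone J = PointedCone.hull ℝ ((fun i => toRealSpace L (a i)) '' (J : Set ι))
  wPos : Finset ι → ℕ
  wNeg : Finset ι → ℕ

namespace SimplicialMultiFan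

variable {ι : Type*} {L : Type*} [AddCommGroup L] (Δ : SimplicialMultiFan ι L)

/-- `Σ⁽ⁿ⁾`, the set of simplices of maximal dimension. -/
def facets : Finset (Finset ι) :=
  Δ.simplices.filter (fun I => I.card = Module.finrank ℤ L)

/-- `w(I) = w⁺(I) - w⁻(I)`. -/
def w (I : Finset ι) : ℤ := (Δ.wPos I : ℤ) - (Δ.wNeg I : ℤ)

/-! ### Projected multi-fans and completeness -/

/-- The linear subspace `(L_K)_ℝ` of `L_ℝ` generated by `C(K)`. -/
def coneSpan (K : Finset ι) : Submodule ℝ (RealSpace L) :=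
  Submodule.span ℝ (Δ.cone K : Set (RealSpace L))

/-- The cone `C_K(J)` of the projected multi-fan `Δ_K`: the image of `C(J)` in
`L_ℝ / (L_K)_ℝ`. -/
def projCone (K J : Finset ι) : PointedCone ℝ (RealSpace L ⧸ Δ.coneSpan K) :=
  (Δ.cone J).map (Δ.coneSpan K).mkQ

/-- Genericity with respect to the projected multi-fan `Δ_K`, whose simplices are the simplices
`J ⊇ K` of `Σ`, with `C_K(J)` of dimension `|J| - |K|`, and whose dimension is `n - |K|`: the
vector lies in no linear subspace spanned by a cone of dimension less than `n - |K|`. -/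
def IsGenericProj (K : Finset ι) (v : RealSpace L ⧸ Δ.coneSpan K) : Prop :=
  ∀ J ∈ Δ.simplices, K ⊆ J → J.card < Module.finrank ℤ L →
    v ∉ Submodule.span ℝ (Δ.projCone K J : Set (RealSpace L ⧸ Δ.coneSpan K))

open Classical in
/-- The integer `d_v` for the projected multi-fan `Δ_K`: the sum of `w(I)` over the simplices
`I ⊇ K` of maximal dimension such that `v ∈ C_K(I)`. -/
def projDegree (K : Finset ι) (v : RealSpace L ⧸ Δ.coneSpan K) : ℤ :=
  ∑ I ∈ Δ.facets with K ⊆ I ∧ v ∈ Δ.projCone K I, Δ.w I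

/-- The projected multi-fan `Δ_K` is pre-complete: `d_v` is the same for all generic `v`. -/
def IsPreCompleteProj (K : Finset ι) : Prop :=
  ∀ v v' : RealSpace L ⧸ Δ.coneSpan K, Δ.IsGenericProj K v → Δ.IsGenericProj K v' →
    Δ.projDegree K v = Δ.projDegree K v'

/-- `Δ` is complete: all projected multi-fans `Δ_K` (including `Δ_∅ = Δ`) are pre-complete. -/
def IsComplete : Prop := ∀ K ∈ Δ.simplices, Δ.IsPreCompleteProj K

/-! ### The face ring -/

/-- The ideal of `ℤ[x_i | i ∈ Σ⁽¹⁾]` generated by the `∏_{i ∈ J} x_i` with `J ∉ Σ`. -/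
def faceIdeal : Ideal (MvPolynomial ι ℤ) :=
  Ideal.span {p | ∃ J : Finset ι, J ∉ Δ.simplices ∧ p = ∏ i ∈ J, MvPolynomial.X i}

/-- `H_T^*(Δ)`, the face ring of `Σ`. -/
abbrev FaceRing : Type _ := MvPolynomial ι ℤ ⧸ Δ.faceIdeal

/-- `H_T^2(Δ)`, the image in the face ring of the linear forms in the `x_i` (which have
cohomological degree two). -/
def equivariantH2 : Submodule ℤ (Δ.FaceRing) :=
  (MvPolynomial.homogeneousSubmodule ι ℤ 1).map
    (Ideal.Quotient.mkₐ ℤ (Δ.faceIdeal)).toLinearMap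

/-- The class of `x_i` in `H_T^2(Δ)`. -/
def xClass (i : ι) : Δ.equivariantH2 :=
  ⟨Ideal.Quotient.mk (Δ.faceIdeal) (MvPolynomial.X i),
    ⟨MvPolynomial.X i, MvPolynomial.isHomogeneous_X ℤ i, rfl⟩⟩

/-- The equivariant first Chern class `c_1^T(Δ, 𝒱) = ∑ x_i`. -/
def equivariantChernClass [Fintype ι] : Δ.equivariantH2 := ∑ i, Δ.xClass i

/-! ### Edge vectors -/

/-- A set `𝒱 = {v_i ∈ L}` of (not necessarily primitive) edge vectors: `v_i` generates the
one-dimensional cone `C(i)`. -/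
structure EdgeVectors where
  vec : ι → L
  hull_eq : ∀ i, PointedCone.hull ℝ {toRealSpace L (vec i)} = Δ.cone {i}

namespace EdgeVectors

variable {Δ} (V : Δ.EdgeVectors)

/-- The edge vectors of a simplex are linearly independent. -/
theorem linearIndependent {I : Finset ι} (hI : I ∈ Δ.simplices) :
    LinearIndependent ℝ (fun i : I => toRealSpace L (V.vec i)) := by
  obtain ⟨a, ha, hcone⟩ := Δ.cone_simplicial I hI
  have key : ∀ i : I, ∃ c : ℝˣ,
      toRealSpace L (V.vec i) = c • toRealSpace L (a i) := by
    intro i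
    have h1 : Δ.cone {(i : ι)} = PointedCone.hull ℝ {toRealSpace L (a i)} := by
      rw [hcone {(i : ι)} (Finset.singleton_subset_iff.2 i.2)]
      simp
    have h2 := (V.hull_eq i).trans h1
    have h3 : toRealSpace L (V.vec i) ∈ PointedCone.hull ℝ {toRealSpace L (a i)} := by
      rw [← h2]
      exact PointedCone.subset_hull rfl
    obtain ⟨c, hc⟩ := Submodule.mem_span_singleton.1 h3
    have hc0 : (c : ℝ) ≠ 0 := by
      intro h0
      have hc' : c = 0 := Subtype.ext h0
      rw [hc', zero_smul] at hc
      have h4 : toRealSpace L (a i) ∈ PointedCone.hull ℝ {toRealSpace L (V.vec i)} := by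
        rw [h2]
        exact PointedCone.subset_hull rfl
      obtain ⟨d, hd⟩ := Submodule.mem_span_singleton.1 h4
      rw [← hc] at hd
      exact ha.ne_zero i (hd.symm.trans (smul_zero _))
    exact ⟨Units.mk0 (c : ℝ) hc0, hc.symm⟩
  choose c hc using key
  have h := ha.units_smul c
  have e : (fun i : I => toRealSpace L (V.vec i)) =
      c • (fun i : I => toRealSpace L (a i)) := funext hc
  rw [e]
  exact h

/-- The sublattice `L_{I,𝒱}` of `L` generated by the `v_i`, `i ∈ I`. -/
def latticeAt (I : Finset ι) : Submodule ℤ L := Submodule.span ℤ (V.vec '' (I : Set ι))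

/-- `L_𝒱`, the intersection of the `L_{I,𝒱}` over all `I ∈ Σ⁽ⁿ⁾`. -/
def lattice : Submodule ℤ L := ⨅ I ∈ Δ.facets, V.latticeAt I

/-- The global type condition (P): `L_{I,𝒱} = L_𝒱` for all `I ∈ Σ⁽ⁿ⁾`. -/
def IsGlobalType : Prop := ∀ I ∈ Δ.facets, V.latticeAt I = V.lattice

/-! ### The first Chern class -/

section ChernClass

variable [Fintype ι]

/-- The map `H^2(BT) = L^* → H_T^2(Δ)`, `u ↦ ∑ ⟨u, v_i⟩ x_i`. -/
def dualToH2 : Module.Dual ℤ L →ₗ[ℤ] Δ.equivariantH2 where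
  toFun u := ∑ i, u (V.vec i) • Δ.xClass i
  map_add' u u' := by simp [add_smul, Finset.sum_add_distrib]
  map_smul' m u := by simp [mul_smul, Finset.smul_sum]

/-- The first Chern class `c_1(Δ, 𝒱)`: the image of `c_1^T(Δ, 𝒱)` in `H_T^2(Δ) / H^2(BT)`. -/
def chernClass : Δ.equivariantH2 ⧸ LinearMap.range V.dualToH2 :=
  (LinearMap.range V.dualToH2).mkQ Δ.equivariantChernClass

/-- `c_1(Δ, 𝒱)` is divisible by `N`. -/
def ChernClassDivisible (N : ℕ) : Prop :=
  ∃ x : Δ.equivariantH2 ⧸ LinearMap.range V.dualToH2, V.chernClass = N • x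

end ChernClass

/-! ### The `T_y`-genus -/

variable [Module.Free ℤ L] [Module.Finite ℤ L]


/-- For `I ∈ Σ⁽ⁿ⁾` the vectors `v_i`, `i ∈ I`, form a basis of `L_ℝ`. -/
def basisAt (I : Δ.facets) : Module.Basis I.1 ℝ (RealSpace L) :=
  basisOfLinearIndependentOfCardEqFinrank' (fun i : I.1 => toRealSpace L (V.vec i))
    (V.linearIndependent (Finset.mem_filter.1 I.2).1)
    (by
      rw [Fintype.card_coe, Module.finrank_baseChange]
      exact (Finset.mem_filter.1 I.2).2)

/-- `u_i^I`, `i ∈ I`: the basis of `L_{I,𝒱}^* ⊆ L_ℝ^*` dual to `{v_i}_{i ∈ I}`. -/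
def dualVec (I : Δ.facets) (i : I.1) : Module.Dual ℝ (RealSpace L) := (V.basisAt I).coord i

/-- The group `H_I = L / L_{I,𝒱}`. -/
abbrev quotientAt (I : Finset ι) : Type _ := L ⧸ V.latticeAt I

/-- For `I ∈ Σ⁽ⁿ⁾` the group `H_I` is finite. -/
instance finite_quotientAt (I : Δ.facets) : Finite (V.quotientAt I.1) := by
  have hI := Finset.mem_filter.1 I.2
  have h1 : LinearIndependent ℤ (fun i : I.1 => toRealSpace L (V.vec i)) :=
    (V.linearIndependent hI.1).restrict_scalars
      (fun a b h => by simpa using h)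
  have h2 : LinearIndependent ℤ (fun i : I.1 => V.vec i) := h1.of_comp (toRealSpace L)
  apply Submodule.finiteQuotientOfFreeOfRankEq
  have h3 := finrank_span_eq_card h2
  rw [Fintype.card_coe, hI.2] at h3
  have h4 : V.latticeAt I.1 = Submodule.span ℤ (Set.range fun i : I.1 => V.vec i) := by
    unfold latticeAt
    rw [Set.image_eq_range]
    rfl
  rw [h4, h3]

instance fintype_quotientAt (I : Δ.facets) : Fintype (V.quotientAt I.1) := Fintype.ofFinite _

/-- `χ_I(u, h) = exp(2π√-1 ⟨u, v(h)⟩)`, where `v(h) ∈ L` is a representative of `h ∈ H_I`. For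
`u ∈ L_{I,𝒱}^*` the value does not depend on the representative. -/
def chi (I : Finset ι) (u : Module.Dual ℝ (RealSpace L)) (h : V.quotientAt I) : ℂ :=
  Complex.exp (2 * Real.pi * Complex.I * (u (toRealSpace L (Quotient.out h)) : ℝ))

end EdgeVectors

/-- The field of fractions of the group ring `ℂ[L_ℝ^*]`, which contains the field of fractions of
`ℂ[L_𝒱^*]` for every set `𝒱` of edge vectors. -/
abbrev CharacterField (L : Type*) [AddCommGroup L] : Type _ :=
  FractionRing (AddMonoidAlgebra ℂ (Module.Dual ℝ (RealSpace L)))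

/-- The element `t^u`. -/
def tPow (u : Module.Dual ℝ (RealSpace L)) : CharacterField L :=
  algebraMap (AddMonoidAlgebra ℂ (Module.Dual ℝ (RealSpace L))) (CharacterField L)
    (AddMonoidAlgebra.single u 1)

namespace EdgeVectors

variable {Δ} [Module.Free ℤ L] [Module.Finite ℤ L] (V : Δ.EdgeVectors)

/-- The equivariant `T_y`-genus
`T_y(Δ, 𝒱) = ∑_I (w(I) / |H_I|) ∑_{h ∈ H_I} ∏_{i ∈ I}
  (1 + y χ_I(u_i^I, h)⁻¹ t^{-u_i^I}) / (1 - χ_I(u_i^I, h)⁻¹ t^{-u_i^I})`. -/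
def equivariantTyGenus (y : ℂ) : CharacterField L :=
  ∑ I : Δ.facets, ((Δ.w I.1 : ℂ) / (Fintype.card (V.quotientAt I.1) : ℂ)) •
    ∑ h : V.quotientAt I.1, ∏ i : I.1,
      ((1 + (y * (V.chi I.1 (V.dualVec I i) h)⁻¹) • tPow (-V.dualVec I i)) /
        (1 - (V.chi I.1 (V.dualVec I i) h)⁻¹ • tPow (-V.dualVec I i)))

end EdgeVectors

/-- `T_y[Δ]` is the number `c`: the equivariant `T_y`-genus `T_y(Δ, 𝒱)` is, for every set `𝒱` of
edge vectors of `Δ`, the constant `c`. -/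
def HasTyGenus [Module.Free ℤ L] [Module.Finite ℤ L] (y c : ℂ) : Prop :=
  ∀ V : Δ.EdgeVectors, V.equivariantTyGenus y = algebraMap ℂ (CharacterField L) c

end SimplicialMultiFan

end

/-! Fix a generic `v` and let `μ(I)` be the number of `i ∈ I` with `⟨u_i^I, v⟩ < 0`. The proof has
two halves.

Rigidity: for complete `Δ` the genus is the constant `∑ w(I) (-y)^μ(I)`. Each summand is expanded as
a formal series in the direction `v`, and summing over `H_I` keeps only exponents integral on `L`.
The coefficient at an exponent `g` is a weighted sum of products over facets (`signSum`). Expanding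
these products over faces `K` gives a combination of the degrees of the projected multi-fans
(`signSum_eq_sum_projDegree`), so completeness makes it independent of `v` and, for fixed values
`q_i`, of the edge vectors. For `g ≠ 0` a suitable change of `v` makes every term zero; only `g = 0`
survives (`equivariantTyGenus_eq`).

Vanishing: by (P), the half-open cones `C(I)`, open on the faces where `v` points outwards, weighted
by `w(I)`, cover `L_𝒱` with constant multiplicity (`sum_coneIndicator`). Translation by an edge
vector in `L_𝒱` preserves this function, so multiplying by `∏ (1 - t^{v_i})` kills it. This gives in
`ℂ[L]` `∑ w(I) ∏_{i ∉ I} (1 - t^{v_i}) ∏_{i ∈ I, ⟨u_i^I, v⟩ < 0} t^{v_i} = 0`. Divisibility of `c_1`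
by `N` yields `u ∈ L^*` with `⟨u, v_i⟩ ≡ 1` modulo `N`, so the character `l ↦ (-y)^⟨u, l⟩` sends
each `t^{v_i}` to `-y`. Evaluating there leaves a power of `1 + y ≠ 0` times `∑ w(I) (-y)^μ(I)`
(`signSum_eq_zero`). -/

open scoped TensorProduct

noncomputable section

/-! ### Formal expansions of rational functions -/

namespace ShiftAction

variable {G : Type*} [AddCommGroup G]

/-- The group ring `ℂ[G]` acts on all functions `G → ℂ` by translations. -/
def act : AddMonoidAlgebra ℂ G →ₐ[ℂ] Module.End ℂ (G → ℂ) :=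
  AddMonoidAlgebra.lift ℂ (Module.End ℂ (G → ℂ)) G
    { toFun := fun g => LinearMap.funLeft ℂ ℂ (fun x => x - g.toAdd)
      map_one' := by
        ext f x
        simp [LinearMap.funLeft_apply]
      map_mul' := fun g h => by
        ext f x
        simp [LinearMap.funLeft_apply, sub_sub] }

theorem act_single (g : G) (r : ℂ) (f : G → ℂ) (x : G) :
    act (AddMonoidAlgebra.single g r) f x = r * f (x - g) := by
  simp [act, AddMonoidAlgebra.lift_single, LinearMap.funLeft_apply]

theorem act_one_sub_single (g : G) (r : ℂ) (f : G → ℂ) (x : G) :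
    act (1 - AddMonoidAlgebra.single g r) f x = f x - r * f (x - g) := by
  simp [map_sub, act_single]

theorem act_mul (a b : AddMonoidAlgebra ℂ G) (f : G → ℂ) : act (a * b) f = act a (act b f) := by
  rw [map_mul]; rfl

theorem act_comm (a b : AddMonoidAlgebra ℂ G) (f : G → ℂ) :
    act a (act b f) = act b (act a f) := by
  rw [← act_mul, mul_comm, act_mul]

open Classical in
/-- The delta function at the origin. -/
def delta : G → ℂ := fun x => if x = 0 then 1 else 0

theorem act_delta (a : AddMonoidAlgebra ℂ G) : act a delta = a.coeff := by
  classical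
  induction a using AddMonoidAlgebra.induction_linear with
  | zero => simp
  | add x y hx hy => simp [map_add, hx, hy]
  | single m r =>
    ext x
    rw [act_single]
    simp [delta, sub_eq_zero, Finsupp.single_apply, eq_comm]

/-- The delta function generates a free module, so identities between functions can be read back as
identities in the group ring. -/
theorem act_delta_injective {a b : AddMonoidAlgebra ℂ G}
    (h : act a delta = act b delta) : a = b := by
  rw [act_delta, act_delta] at h
  exact AddMonoidAlgebra.ext (DFunLike.coe_injective h)

/-- A product of functions of independent coordinates satisfies the product of the
one-dimensional difference equations. -/
theorem act_prod_coord {I : Type*} [Fintype I] [DecidableEq I] (e : I → G) (x : I → G →+ ℝ)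
    (hxe : ∀ i j, x i (e j) = if i = j then 1 else 0) (f : I → ℝ → ℂ) (α β γ : I → ℂ)
    (hf : ∀ i a, f i a - α i * f i (a - 1) = β i * delta a + γ i * delta (a - 1)) :
    act (∏ i, (1 - AddMonoidAlgebra.single (e i) (α i))) (fun g => ∏ i, f i (x i g)) =
      act (∏ i, (AddMonoidAlgebra.single 0 (β i) + AddMonoidAlgebra.single (e i) (γ i)))
        (fun g => ∏ i, delta (x i g)) := by
  -- Induction on the set `s` of coordinates that carry `f` instead of `delta`; translation by `e j`
  -- moves only the `j`-th coordinate.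
  have key : ∀ s : Finset I,
      act (∏ i ∈ s, (1 - AddMonoidAlgebra.single (e i) (α i)))
        (fun g => ∏ i, (if i ∈ s then f i else delta) (x i g)) =
      act (∏ i ∈ s, (AddMonoidAlgebra.single 0 (β i) + AddMonoidAlgebra.single (e i) (γ i)))
        (fun g => ∏ i, delta (x i g)) := by
    intro s
    induction s using Finset.induction_on with
    | empty => simp
    | insert j s hj ih =>
      have step : act (1 - AddMonoidAlgebra.single (e j) (α j))
          (fun g => ∏ i, (if i ∈ insert j s then f i else delta) (x i g)) =
          act (AddMonoidAlgebra.single 0 (β j) + AddMonoidAlgebra.single (e j) (γ j))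
          (fun g => ∏ i, (if i ∈ s then f i else delta) (x i g)) := by
        ext g
        have hsplit : ∀ (t : Finset I) (h : G),
            ∏ i, (if i ∈ t then f i else delta) (x i h) =
              (if j ∈ t then f j else delta) (x j h) *
                ∏ i ∈ Finset.univ.erase j, (if i ∈ t then f i else delta) (x i h) :=
          fun t h => (Finset.mul_prod_erase _ _ (Finset.mem_univ j)).symm
        have hrest : ∀ (t : Finset I), t = s ∨ t = insert j s → ∀ h, (h = g ∨ h = g - e j) →
            ∏ i ∈ Finset.univ.erase j, (if i ∈ t then f i else delta) (x i h) =
            ∏ i ∈ Finset.univ.erase j, (if i ∈ s then f i else delta) (x i g) := by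
          intro t ht h hh
          refine Finset.prod_congr rfl fun i hi => ?_
          have hij : i ≠ j := (Finset.mem_erase.1 hi).1
          have h1 : x i h = x i g := by
            rcases hh with rfl | rfl
            · rfl
            · simp [hxe, hij]
          have h2 : i ∈ t ↔ i ∈ s := by
            rcases ht with rfl | rfl
            · rfl
            · simp [hij]
          simp only [h1, h2]
        have hxj : x j (g - e j) = x j g - 1 := by simp [hxe]
        rw [act_one_sub_single, map_add, LinearMap.add_apply, Pi.add_apply, act_single,
          act_single, hsplit (insert j s) g, hsplit (insert j s) (g - e j), sub_zero,
          hsplit s g, hsplit s (g - e j), hrest _ (Or.inr rfl) _ (Or.inl rfl),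
          hrest _ (Or.inr rfl) _ (Or.inr rfl), hrest _ (Or.inl rfl) _ (Or.inr rfl), hxj]
        simp only [Finset.mem_insert_self, if_true, hj, if_false]
        linear_combination (∏ i ∈ Finset.univ.erase j, (if i ∈ s then f i else delta) (x i g)) *
          hf j (x j g)
      rw [Finset.prod_insert hj, Finset.prod_insert hj, mul_comm, act_mul, step, act_comm, ih,
        ← act_mul]
  simpa using key Finset.univ

theorem prod_delta_eq_delta {I : Type*} [Fintype I] (x : I → G →+ ℝ)
    (hx : ∀ g, (∀ i, x i g = 0) → g = 0) :
    (fun g => ∏ i, delta (x i g)) = (delta : G → ℂ) := by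
  classical
  ext g
  by_cases hg : g = 0
  · simp [delta, hg]
  · have : ∃ i, x i g ≠ 0 := by
      by_contra! h
      exact hg (hx g h)
    obtain ⟨i, hi⟩ := this
    rw [Finset.prod_eq_zero (Finset.mem_univ i) (by simp [delta, hi])]
    simp [delta, hg]

/-- The function `F` is a formal (possibly infinite) expansion of the rational function `r`. -/
def Expands (r : FractionRing (AddMonoidAlgebra ℂ G)) (F : G → ℂ) : Prop :=
  ∃ P Q : AddMonoidAlgebra ℂ G, Q ≠ 0 ∧
    r * algebraMap (AddMonoidAlgebra ℂ G) (FractionRing (AddMonoidAlgebra ℂ G)) Q =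
      algebraMap (AddMonoidAlgebra ℂ G) (FractionRing (AddMonoidAlgebra ℂ G)) P ∧
    act Q F = act P delta

theorem Expands.zero : Expands (0 : FractionRing (AddMonoidAlgebra ℂ G)) 0 :=
  ⟨0, 1, one_ne_zero, by simp, by simp⟩

theorem Expands.smul {r : FractionRing (AddMonoidAlgebra ℂ G)} {F : G → ℂ} (c : ℂ)
    (h : Expands r F) : Expands (c • r) (c • F) := by
  obtain ⟨P, Q, hQ, h1, h2⟩ := h
  refine ⟨c • P, Q, hQ, ?_, ?_⟩
  · rw [smul_mul_assoc, h1, Algebra.smul_def, Algebra.smul_def, map_mul]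
    rfl
  · rw [map_smul, map_smul, LinearMap.smul_apply, h2]

variable [IsDomain (AddMonoidAlgebra ℂ G)]

theorem Expands.add {r r' : FractionRing (AddMonoidAlgebra ℂ G)} {F F' : G → ℂ}
    (h : Expands r F) (h' : Expands r' F') : Expands (r + r') (F + F') := by
  obtain ⟨P, Q, hQ, h1, h2⟩ := h
  obtain ⟨P', Q', hQ', h1', h2'⟩ := h'
  refine ⟨P * Q' + P' * Q, Q * Q', mul_ne_zero hQ hQ', ?_, ?_⟩
  · simp only [map_mul, map_add, ← h1, ← h1']
    ring
  · rw [map_add, map_add, LinearMap.add_apply, act_mul, act_comm, h2, mul_comm P Q', act_mul,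
      act_mul, h2', mul_comm P' Q, act_mul]

theorem Expands.sum {J : Type*} (s : Finset J) (r : J → FractionRing (AddMonoidAlgebra ℂ G))
    (F : J → G → ℂ) (h : ∀ j ∈ s, Expands (r j) (F j)) :
    Expands (∑ j ∈ s, r j) (∑ j ∈ s, F j) := by
  classical
  induction s using Finset.induction_on with
  | empty => simpa using Expands.zero
  | insert j s hj ih =>
    rw [Finset.sum_insert hj, Finset.sum_insert hj]
    exact (h j (Finset.mem_insert_self _ _)).add
      (ih fun i hi => h i (Finset.mem_insert_of_mem hi))

/-- A rational function has many expansions, depending on the direction, but an expansion determines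
the function: here `P = cQ` by freeness of the delta function. -/
theorem Expands.eq_algebraMap {r : FractionRing (AddMonoidAlgebra ℂ G)} {c : ℂ}
    (h : Expands r (c • delta)) : r = algebraMap ℂ (FractionRing (AddMonoidAlgebra ℂ G)) c := by
  obtain ⟨P, Q, hQ, h1, h2⟩ := h
  have h3 : P = c • Q := by
    apply act_delta_injective
    rw [← h2, map_smul, map_smul, LinearMap.smul_apply]
  have hQ' : algebraMap (AddMonoidAlgebra ℂ G) (FractionRing (AddMonoidAlgebra ℂ G)) Q ≠ 0 := by
    simpa using hQ
  apply mul_right_cancel₀ hQ'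
  rw [h1, h3, Algebra.smul_def, map_mul]
  rfl

end ShiftAction

end

/-! ### Generic vectors, dual coordinates and projected cones -/

noncomputable section

namespace SimplicialMultiFan

variable {ι : Type*} {L : Type*} [AddCommGroup L] (Δ : SimplicialMultiFan ι L)

/-- A vector of `L_ℝ` is generic if it lies in no subspace spanned by a cone of dimension less
than `n`. -/
def IsGeneric (v : RealSpace L) : Prop :=
  ∀ J ∈ Δ.simplices, J.card < Module.finrank ℤ L → v ∉ Δ.coneSpan J

variable {Δ}

theorem IsGeneric.neg {v : RealSpace L} (hv : Δ.IsGeneric v) : Δ.IsGeneric (-v) := by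
  intro J hJ hc h
  exact hv J hJ hc (by simpa using h)

theorem mem_simplices {I : Finset ι} (hI : I ∈ Δ.facets) : I ∈ Δ.simplices :=
  (Finset.mem_filter.1 hI).1

theorem card_eq_finrank {I : Finset ι} (hI : I ∈ Δ.facets) : I.card = Module.finrank ℤ L :=
  (Finset.mem_filter.1 hI).2

theorem cone_mono {J K : Finset ι} (hK : K ∈ Δ.simplices) (h : J ⊆ K) : Δ.cone J ≤ Δ.cone K := by
  obtain ⟨a, -, ha⟩ := Δ.cone_simplicial K hK
  rw [ha J h, ha K subset_rfl]
  exact Submodule.span_mono (Set.image_mono (by simpa using h))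

/-- The span of `C_K(J)` is the image of the span of `C(J)`, which contains the span of `C(K)`; so
membership lifts from the quotient. -/
theorem IsGeneric.proj {v : RealSpace L} (hv : Δ.IsGeneric v) (K : Finset ι) :
    Δ.IsGenericProj K ((Δ.coneSpan K).mkQ v) := by
  intro J hJ hKJ hc h
  apply hv J hJ hc
  have h1 : (Δ.projCone K J : Set (RealSpace L ⧸ Δ.coneSpan K)) =
      (Δ.coneSpan K).mkQ '' (Δ.cone J : Set (RealSpace L)) := by
    rw [projCone]
    exact PointedCone.coe_map _ _
  rw [h1, Submodule.span_image] at h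
  obtain ⟨c, hc1, hc2⟩ := h
  have h2 : c - v ∈ Δ.coneSpan K := by
    rw [← Submodule.ker_mkQ (Δ.coneSpan K), LinearMap.mem_ker, map_sub, hc2, sub_self]
  have h3 : Δ.coneSpan K ≤ Δ.coneSpan J := Submodule.span_mono (cone_mono hJ hKJ)
  have h4 : v = c - (c - v) := by abel
  rw [h4]
  exact Submodule.sub_mem _ hc1 (h3 h2)

namespace EdgeVectors

variable (V : Δ.EdgeVectors)

/-- A cone is the sum of its rays, and the rays are the cones `C(i)`; hence the generators supplied
by the structure may be replaced by any edge vectors. -/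
theorem cone_eq_hull {J : Finset ι} (hJ : J ∈ Δ.simplices) :
    Δ.cone J = PointedCone.hull ℝ ((fun i => toRealSpace L (V.vec i)) '' (J : Set ι)) := by
  obtain ⟨a, -, ha⟩ := Δ.cone_simplicial J hJ
  have key : ∀ b : ι → RealSpace L, PointedCone.hull ℝ (b '' (J : Set ι)) =
      ⨆ i ∈ J, PointedCone.hull ℝ {b i} := by
    intro b
    rw [← Set.biUnion_of_singleton (b '' (J : Set ι)), Set.biUnion_image, PointedCone.hull,
      Submodule.span_iUnion₂]
    rfl
  rw [ha J subset_rfl, key, key]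
  refine iSup_congr fun i => iSup_congr fun hi => ?_
  rw [V.hull_eq, ha {i} (by simpa using hi)]
  simp

theorem coneSpan_eq_span {J : Finset ι} (hJ : J ∈ Δ.simplices) :
    Δ.coneSpan J = Submodule.span ℝ ((fun i => toRealSpace L (V.vec i)) '' (J : Set ι)) := by
  rw [coneSpan, V.cone_eq_hull hJ]
  apply le_antisymm
  · rw [Submodule.span_le]
    intro x hx
    exact Submodule.span_le_restrictScalars {c : ℝ // 0 ≤ c} ℝ _ hx
  · exact Submodule.span_mono Submodule.subset_span

variable [Module.Free ℤ L] [Module.Finite ℤ L]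

open Classical in
/-- The linear form `u_i^I`, extended by zero to the vertices `i` outside `I`. -/
def facetCoord (I : Δ.facets) (i : ι) : Module.Dual ℝ (RealSpace L) :=
  if h : i ∈ I.1 then V.dualVec I ⟨i, h⟩ else 0

theorem facetCoord_coe (I : Δ.facets) (i : I.1) : V.facetCoord I i = V.dualVec I i := by
  simp [facetCoord]

theorem basisAt_apply (I : Δ.facets) (i : I.1) :
    V.basisAt I i = toRealSpace L (V.vec i) := by
  simp [basisAt]

theorem dualVec_vec [DecidableEq ι] (I : Δ.facets) (i j : I.1) :
    V.dualVec I i (toRealSpace L (V.vec j)) = if i = j then 1 else 0 := by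
  rw [← V.basisAt_apply, dualVec, Module.Basis.coord_apply, Module.Basis.repr_self,
    Finsupp.single_apply]
  simp [eq_comm]

theorem facetCoord_vec_self (I : Δ.facets) {i : ι} (hi : i ∈ I.1) :
    V.facetCoord I i (toRealSpace L (V.vec i)) = 1 := by
  classical
  have := V.dualVec_vec I ⟨i, hi⟩ ⟨i, hi⟩
  rw [← V.facetCoord_coe] at this
  simpa using this

theorem facetCoord_vec_of_ne (I : Δ.facets) {i j : ι} (hj : j ∈ I.1) (hij : i ≠ j) :
    V.facetCoord I i (toRealSpace L (V.vec j)) = 0 := by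
  classical
  by_cases hi : i ∈ I.1
  · have := V.dualVec_vec I ⟨i, hi⟩ ⟨j, hj⟩
    rw [← V.facetCoord_coe] at this
    simpa [hij] using this
  · simp [facetCoord, hi]

theorem sum_facetCoord (I : Δ.facets) (v : RealSpace L) :
    ∑ i ∈ I.1, V.facetCoord I i v • toRealSpace L (V.vec i) = v := by
  rw [← Finset.sum_coe_sort]
  simp only [facetCoord_coe, ← V.basisAt_apply]
  exact (V.basisAt I).sum_repr v

theorem mem_coneSpan_of_facetCoord_eq_zero (I : Δ.facets) {K : Finset ι} (hK : K ⊆ I.1)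
    {v : RealSpace L} (h : ∀ i ∈ I.1, i ∉ K → V.facetCoord I i v = 0) : v ∈ Δ.coneSpan K := by
  rw [V.coneSpan_eq_span (Δ.down_closed _ (mem_simplices I.2) _ hK), ← V.sum_facetCoord I v]
  refine Submodule.sum_mem _ fun i hi => ?_
  by_cases hiK : i ∈ K
  · exact Submodule.smul_mem _ _ (Submodule.subset_span ⟨i, hiK, rfl⟩)
  · rw [h i hi hiK, zero_smul]
    exact Submodule.zero_mem _

theorem facetCoord_eq_zero_of_mem_coneSpan (I : Δ.facets) {K : Finset ι} (hK : K ⊆ I.1)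
    {v : RealSpace L} (hv : v ∈ Δ.coneSpan K) {i : ι} (hiK : i ∉ K) : V.facetCoord I i v = 0 := by
  rw [V.coneSpan_eq_span (Δ.down_closed _ (mem_simplices I.2) _ hK)] at hv
  rw [← LinearMap.mem_ker]
  refine (Submodule.span_le (p := LinearMap.ker (V.facetCoord I i))).2 ?_ hv
  rintro _ ⟨j, hj, rfl⟩
  exact V.facetCoord_vec_of_ne I (hK hj) (by rintro rfl; exact hiK hj)

theorem facetCoord_ne_zero (I : Δ.facets) {v : RealSpace L} (hv : Δ.IsGeneric v) {i : ι}
    (hi : i ∈ I.1) : V.facetCoord I i v ≠ 0 := by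
  classical
  intro h
  refine hv (I.1.erase i)
    (Δ.down_closed _ (mem_simplices I.2) _ (Finset.erase_subset _ _)) ?_ ?_
  · rw [← card_eq_finrank I.2]
    exact Finset.card_erase_lt_of_mem hi
  · apply V.mem_coneSpan_of_facetCoord_eq_zero I (Finset.erase_subset _ _)
    intro j hj hj'
    have : j = i := by
      by_contra hne
      exact hj' (Finset.mem_erase.2 ⟨hne, hj⟩)
    rwa [this]

theorem mem_cone_iff (I : Δ.facets) (v : RealSpace L) :
    v ∈ Δ.cone I.1 ↔ ∀ i ∈ I.1, 0 ≤ V.facetCoord I i v := by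
  rw [V.cone_eq_hull (mem_simplices I.2)]
  constructor
  · intro hv i hi
    induction hv using Submodule.span_induction with
    | mem x hx =>
      obtain ⟨j, hj, rfl⟩ := hx
      by_cases hij : i = j
      · subst hij
        simp [V.facetCoord_vec_self I hi]
      · simp [V.facetCoord_vec_of_ne I hj hij]
    | zero => simp
    | add x y _ _ hx hy => simpa using add_nonneg hx hy
    | smul c x _ hx =>
      have : c • x = (c : ℝ) • x := rfl
      rw [this, map_smul]
      exact mul_nonneg c.2 hx
  · intro h
    rw [← V.sum_facetCoord I v]
    refine Submodule.sum_mem _ fun i hi => ?_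
    exact Submodule.smul_mem _ (⟨_, h i hi⟩ : {c : ℝ // 0 ≤ c})
      (Submodule.subset_span ⟨i, hi, rfl⟩)

/-- Modulo the span of `C(K)` the coordinates indexed by `K` are free: subtracting the `K`-part `r`
of `v` makes them zero and leaves the others unchanged. -/
theorem mkQ_mem_projCone_iff (I : Δ.facets) {K : Finset ι} (hK : K ⊆ I.1) (v : RealSpace L) :
    (Δ.coneSpan K).mkQ v ∈ Δ.projCone K I.1 ↔
      ∀ i ∈ I.1, i ∉ K → 0 ≤ V.facetCoord I i v := by
  classical
  rw [projCone, PointedCone.mem_map]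
  constructor
  · rintro ⟨c, hc, hcv⟩ i hi hiK
    have h1 : c - v ∈ Δ.coneSpan K := by
      rw [← Submodule.ker_mkQ (Δ.coneSpan K), LinearMap.mem_ker, map_sub, hcv, sub_self]
    have h2 := V.facetCoord_eq_zero_of_mem_coneSpan I hK h1 hiK
    rw [map_sub, sub_eq_zero] at h2
    rw [← h2]
    exact (V.mem_cone_iff I c).1 hc i hi
  · intro h
    set r := ∑ i ∈ K, V.facetCoord I i v • toRealSpace L (V.vec i) with hr
    have hrK : r ∈ Δ.coneSpan K := by
      rw [V.coneSpan_eq_span (Δ.down_closed _ (mem_simplices I.2) _ hK)]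
      exact Submodule.sum_mem _ fun i hi =>
        Submodule.smul_mem _ _ (Submodule.subset_span ⟨i, hi, rfl⟩)
    refine ⟨v - r, (V.mem_cone_iff I _).2 fun i hi => ?_, ?_⟩
    · by_cases hiK : i ∈ K
      · have : V.facetCoord I i r = V.facetCoord I i v := by
          rw [hr, map_sum, Finset.sum_eq_single_of_mem i hiK]
          · rw [map_smul, V.facetCoord_vec_self I hi, smul_eq_mul, mul_one]
          · intro j hj hji
            rw [map_smul, V.facetCoord_vec_of_ne I (hK hj) hji.symm, smul_zero]
        rw [map_sub, this, sub_self]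
      · rw [map_sub, V.facetCoord_eq_zero_of_mem_coneSpan I hK hrK hiK, sub_zero]
        exact h i hi hiK
    · rw [map_sub, sub_eq_self, ← LinearMap.mem_ker, Submodule.ker_mkQ]
      exact hrK

end EdgeVectors

theorem finrank_coneSpan_le (V : Δ.EdgeVectors) {J : Finset ι} (hJ : J ∈ Δ.simplices) :
    Module.finrank ℝ (Δ.coneSpan J) ≤ J.card := by
  classical
  rw [V.coneSpan_eq_span hJ, ← Finset.coe_image]
  exact (finrank_span_finset_le_card _).trans Finset.card_image_le

section Existence

variable [Module.Free ℤ L]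

/-- There is a generic vector on which a given nonzero linear form is negative. -/
theorem exists_isGeneric_neg (V : Δ.EdgeVectors) {u : Module.Dual ℝ (RealSpace L)} (hu : u ≠ 0) :
    ∃ v, Δ.IsGeneric v ∧ u v < 0 := by
  classical
  -- A real vector space is not a finite union of proper subspaces. Including `ker u` gives `u v ≠
  -- 0`, and the sign is then corrected by passing to `-v`.
  set s : Finset (Subspace ℝ (RealSpace L)) := insert (LinearMap.ker u)
    ((Δ.simplices.filter fun J => J.card < Module.finrank ℤ L).image Δ.coneSpan) with hs
  have htop : ⊤ ∉ s := by
    rw [hs, Finset.mem_insert, Finset.mem_image]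
    rintro (h | ⟨J, hJ, h⟩)
    · exact hu (LinearMap.ker_eq_top.1 h.symm)
    · have h1 := finrank_coneSpan_le V (Finset.mem_filter.1 hJ).1
      rw [h, finrank_top, Module.finrank_baseChange] at h1
      exact absurd (Finset.mem_filter.1 hJ).2 (not_lt.2 h1)
  have h1 := Subspace.biUnion_ne_univ_of_top_notMem htop
  obtain ⟨v, hv⟩ := (Set.ne_univ_iff_exists_notMem _).1 h1
  simp only [Set.mem_iUnion, not_exists] at hv
  have hgen : Δ.IsGeneric v := fun J hJ hc hvJ => hv (Δ.coneSpan J)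
    (Finset.mem_insert_of_mem (Finset.mem_image_of_mem _ (Finset.mem_filter.2 ⟨hJ, hc⟩))) hvJ
  have huv : u v ≠ 0 := fun h => hv (LinearMap.ker u) (Finset.mem_insert_self _ _) h
  rcases lt_or_gt_of_ne huv with h | h
  · exact ⟨v, hgen, h⟩
  · exact ⟨-v, hgen.neg, by simpa using h⟩

variable [Module.Finite ℤ L]

theorem exists_isGeneric (V : Δ.EdgeVectors) (hn : 1 ≤ Module.finrank ℤ L) :
    ∃ v, Δ.IsGeneric v := by
  obtain ⟨I, hI, hc⟩ := Δ.exists_card_eq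
  have hI' : I ∈ Δ.facets := Finset.mem_filter.2 ⟨hI, hc⟩
  obtain ⟨i, hi⟩ : I.Nonempty := Finset.card_pos.1 (by omega)
  have : V.facetCoord ⟨I, hI'⟩ i ≠ 0 := by
    intro h
    have h1 := V.facetCoord_vec_self ⟨I, hI'⟩ hi
    rw [h] at h1
    simp at h1
  obtain ⟨v, hv, -⟩ := exists_isGeneric_neg V this
  exact ⟨v, hv⟩

end Existence

/-! ### Weighted sums over facets and their invariance -/

namespace EdgeVectors

variable [Module.Free ℤ L] [Module.Finite ℤ L] (V : Δ.EdgeVectors)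

open Classical in
/-- The sum over the facets `I` of the products of `q_i + κ` over the `i ∈ I` with
`⟨u_i^I, v⟩ > 0` and of `q_i` over the other `i ∈ I`. -/
def signSum (κ : ℂ) (q : ι → ℂ) (v : RealSpace L) : ℂ :=
  ∑ I : Δ.facets, (Δ.w I.1 : ℂ) *
    ∏ i ∈ I.1, (if 0 < V.facetCoord I i v then q i + κ else q i)

/-- Expand each product by the set `K ⊆ I` of factors contributing `q_i`. The remaining factors are
all `κ` exactly when the image of `v` lies in `C_K(I)`, and otherwise one of them is zero.
Exchanging the sums over `I` and `K` produces the degrees. -/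
theorem signSum_eq_sum_projDegree (κ : ℂ) (q : ι → ℂ) {v : RealSpace L} (hv : Δ.IsGeneric v) :
    V.signSum κ q v = ∑ K ∈ Δ.simplices, (∏ i ∈ K, q i) * κ ^ (Module.finrank ℤ L - K.card) *
      (Δ.projDegree K ((Δ.coneSpan K).mkQ v) : ℂ) := by
  classical
  have h1 : ∀ I : Δ.facets,
      ∏ i ∈ I.1, (if 0 < V.facetCoord I i v then q i + κ else q i) =
      ∑ K ∈ Δ.simplices, if K ⊆ I.1 ∧ (Δ.coneSpan K).mkQ v ∈ Δ.projCone K I.1 then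
        (∏ i ∈ K, q i) * κ ^ (Module.finrank ℤ L - K.card) else 0 := by
    intro I
    have h2 : ∀ i ∈ I.1, (if 0 < V.facetCoord I i v then q i + κ else q i) =
        q i + (if 0 < V.facetCoord I i v then κ else 0) := by
      intro i _
      split_ifs <;> simp
    rw [Finset.prod_congr rfl h2, Finset.prod_add]
    have hsub : I.1.powerset ⊆ Δ.simplices := fun K hK =>
      Δ.down_closed _ (mem_simplices I.2) _ (Finset.mem_powerset.1 hK)
    rw [← Finset.sum_subset hsub]
    · refine Finset.sum_congr rfl fun K hK => ?_
      have hK' := Finset.mem_powerset.1 hK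
      rw [V.mkQ_mem_projCone_iff I hK']
      split_ifs with h
      · rw [← card_eq_finrank I.2, ← Finset.card_sdiff_of_subset hK']
        congr 1
        apply Finset.prod_eq_pow_card
        intro i hi
        rw [Finset.mem_sdiff] at hi
        rw [if_pos]
        exact lt_of_le_of_ne (h.2 i hi.1 hi.2) (V.facetCoord_ne_zero I hv hi.1).symm
      · have : ∃ i ∈ I.1, i ∉ K ∧ V.facetCoord I i v < 0 := by
          by_contra! h'
          exact h ⟨hK', h'⟩
        obtain ⟨i, hi, hiK, hlt⟩ := this
        rw [Finset.prod_eq_zero (Finset.mem_sdiff.2 ⟨hi, hiK⟩) (if_neg hlt.not_gt), mul_zero]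
    · intro K _ hK
      rw [if_neg fun h => hK (Finset.mem_powerset.2 h.1)]
  unfold signSum
  simp only [h1, Finset.mul_sum]
  rw [Finset.sum_comm]
  refine Finset.sum_congr rfl fun K _ => ?_
  rw [projDegree, Finset.sum_filter, Int.cast_sum, Finset.mul_sum,
    Finset.sum_coe_sort Δ.facets (fun I => (Δ.w I : ℂ) *
      if K ⊆ I ∧ (Δ.coneSpan K).mkQ v ∈ Δ.projCone K I then
        (∏ i ∈ K, q i) * κ ^ (Module.finrank ℤ L - K.card) else 0)]
  refine Finset.sum_congr rfl fun I _ => ?_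
  split_ifs <;> simp [mul_comm]

/-- The degrees of the projected multi-fans do not involve edge vectors, and completeness makes them
independent of the generic vector. -/
theorem signSum_eq_signSum (hΔ : Δ.IsComplete) (V' : Δ.EdgeVectors) (κ : ℂ) (q : ι → ℂ)
    {v v' : RealSpace L} (hv : Δ.IsGeneric v) (hv' : Δ.IsGeneric v') :
    V.signSum κ q v = V'.signSum κ q v' := by
  rw [V.signSum_eq_sum_projDegree κ q hv, V'.signSum_eq_sum_projDegree κ q hv']
  refine Finset.sum_congr rfl fun K hK => ?_
  rw [hΔ K hK _ _ (hv.proj K) (hv'.proj K)]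

end EdgeVectors

end SimplicialMultiFan

end

/-! ### Rigidity of the equivariant genus -/

noncomputable section

namespace SimplicialMultiFan

open ShiftAction

/-- The coefficients of `(1 + y z) / (1 - z)` expanded in powers of `z`. -/
def tyCoeff (y : ℂ) (a : ℝ) : ℂ := if a = 0 then 1 else if 0 < a then 1 + y else 0

/-- Compares coefficients in `(1 - z) · series = 1 + y z`. It fails strictly between integers, which
is why `tyExpansion` is cut off outside `ℤ`. -/
theorem tyCoeff_sub (y : ℂ) (k : ℤ) :
    tyCoeff y k - tyCoeff y ((k : ℝ) - 1) = delta (k : ℝ) + y * delta ((k : ℝ) - 1) := by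
  have e : (k : ℝ) - 1 = ((k - 1 : ℤ) : ℝ) := by push_cast; ring
  rw [e]
  simp only [tyCoeff, delta, Int.cast_eq_zero, Int.cast_pos]
  rcases lt_trichotomy k 0 with h | h | h
  · have h1 : ¬ k = 0 := by omega
    have h2 : ¬ 0 < k := by omega
    have h3 : ¬ k - 1 = 0 := by omega
    have h4 : ¬ 1 < k := by omega
    simp [h1, h2, h3, h4]
  · subst h
    simp
  · by_cases h' : k = 1
    · subst h'
      simp
    · have h1 : ¬ k = 0 := by omega
      have h3 : ¬ k - 1 = 0 := by omega
      have h4 : 1 < k := by omega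
      simp [h1, h, h3, h4]

open Classical in
/-- The coefficients of `(1 + y z) / (1 - z)` at `z = exp(-2π√-1 θ) t`, expanded in powers of `t`
if `s` holds and in powers of `t⁻¹` otherwise. -/
def tyExpansion (y : ℂ) (s : Prop) (θ a : ℝ) : ℂ :=
  if a ∈ Set.range ((↑) : ℤ → ℝ) then
    (if s then tyCoeff y a - (1 + y) + (1 + y) else tyCoeff y a - (1 + y)) *
      Complex.exp (-(2 * Real.pi * Complex.I * (a * θ : ℝ)))
  else 0

theorem tyExpansion_sub (y : ℂ) (s : Prop) (θ a : ℝ) :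
    tyExpansion y s θ a -
      (Complex.exp (2 * Real.pi * Complex.I * (θ : ℝ)))⁻¹ * tyExpansion y s θ (a - 1) =
    1 * delta a + y * (Complex.exp (2 * Real.pi * Complex.I * (θ : ℝ)))⁻¹ * delta (a - 1) := by
  classical
  by_cases ha : a ∈ Set.range ((↑) : ℤ → ℝ)
  · have ha1 : a - 1 ∈ Set.range ((↑) : ℤ → ℝ) := by
      obtain ⟨k, rfl⟩ := ha
      exact ⟨k - 1, by push_cast; ring⟩
    have hexp : Complex.exp (-(2 * Real.pi * Complex.I * (a * θ : ℝ))) =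
        (Complex.exp (2 * Real.pi * Complex.I * (θ : ℝ)))⁻¹ *
          Complex.exp (-(2 * Real.pi * Complex.I * ((a - 1) * θ : ℝ))) := by
      rw [← Complex.exp_neg, ← Complex.exp_add]
      congr 1
      push_cast
      ring
    have hd0 : Complex.exp (-(2 * Real.pi * Complex.I * (a * θ : ℝ))) * delta a = delta a := by
      by_cases h : a = 0
      · simp [h]
      · simp [delta, h]
    have hd1 : Complex.exp (-(2 * Real.pi * Complex.I * (a * θ : ℝ))) * delta (a - 1) =
        (Complex.exp (2 * Real.pi * Complex.I * (θ : ℝ)))⁻¹ * delta (a - 1) := by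
      by_cases h : a = 1
      · simp [h, Complex.exp_neg]
      · simp [delta, sub_eq_zero, h]
    -- The expansions in `t` and `t⁻¹` differ by the constant `1 + y`, which the difference operator
    -- kills. The form `q + (1 + y)` is left unsimplified to match the factors of `signSum`.
    have hc : (if s then tyCoeff y a - (1 + y) + (1 + y) else tyCoeff y a - (1 + y)) -
        (if s then tyCoeff y (a - 1) - (1 + y) + (1 + y) else tyCoeff y (a - 1) - (1 + y)) =
        delta a + y * delta (a - 1) := by
      obtain ⟨k, rfl⟩ := ha
      rw [← tyCoeff_sub]
      split_ifs <;> ring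
    simp only [tyExpansion, ha, ha1, if_true]
    linear_combination
      Complex.exp (-(2 * Real.pi * Complex.I * (a * θ : ℝ))) * hc + hd0 + y * hd1 +
        (if s then tyCoeff y (a - 1) - (1 + y) + (1 + y) else tyCoeff y (a - 1) - (1 + y)) * hexp
  · have ha1 : a - 1 ∉ Set.range ((↑) : ℤ → ℝ) := by
      rintro ⟨k, hk⟩
      exact ha ⟨k + 1, by push_cast; linarith⟩
    have h0 : a ≠ 0 := by
      rintro rfl
      exact ha ⟨0, by simp⟩
    have h1 : a - 1 ≠ 0 := by
      intro h
      exact ha1 ⟨0, by simp [h]⟩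
    rw [tyExpansion, tyExpansion, if_neg ha, if_neg ha1]
    simp [delta, h0, h1]

variable {ι : Type*} {L : Type*} [AddCommGroup L] {Δ : SimplicialMultiFan ι L}

namespace EdgeVectors

variable (V : Δ.EdgeVectors)

/-- Orthogonality of characters for the group `H_I`. -/
theorem sum_exp_quotientAt (I : Finset ι) [Fintype (V.quotientAt I)]
    (g : Module.Dual ℝ (RealSpace L))
    (hg : ∀ i ∈ I, g (toRealSpace L (V.vec i)) ∈ Set.range ((↑) : ℤ → ℝ)) [Decidable
      (∀ l, g (toRealSpace L l) ∈ Set.range ((↑) : ℤ → ℝ))] :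
    ∑ h : V.quotientAt I,
      Complex.exp (2 * Real.pi * Complex.I * (g (toRealSpace L (Quotient.out h)) : ℝ)) =
    if ∀ l, g (toRealSpace L l) ∈ Set.range ((↑) : ℤ → ℝ) then
      (Fintype.card (V.quotientAt I) : ℂ) else 0 := by
  have hone : ∀ a : ℝ, Complex.exp (2 * Real.pi * Complex.I * (a : ℝ)) = 1 ↔
      a ∈ Set.range ((↑) : ℤ → ℝ) := by
    intro a
    rw [Complex.exp_eq_one_iff]
    constructor
    · rintro ⟨k, hk⟩
      refine ⟨k, ?_⟩
      have h2 : (2 * Real.pi * Complex.I : ℂ) ≠ 0 := Complex.two_pi_I_ne_zero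
      rw [mul_comm (k : ℂ)] at hk
      have := mul_left_cancel₀ h2 hk
      exact_mod_cast this.symm
    · rintro ⟨k, rfl⟩
      exact ⟨k, by push_cast; ring⟩
  have hlat : ∀ l ∈ V.latticeAt I, g (toRealSpace L l) ∈ Set.range ((↑) : ℤ → ℝ) := by
    intro l hl
    induction hl using Submodule.span_induction with
    | mem x hx =>
      obtain ⟨i, hi, rfl⟩ := hx
      exact hg i hi
    | zero => exact ⟨0, by simp⟩
    | add x y _ _ hx hy =>
      obtain ⟨a, ha⟩ := hx
      obtain ⟨b, hb⟩ := hy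
      exact ⟨a + b, by rw [map_add, map_add, ← ha, ← hb]; push_cast; rfl⟩
    | smul c x _ hx =>
      obtain ⟨a, ha⟩ := hx
      exact ⟨c * a, by rw [map_smul, map_zsmul, ← ha, zsmul_eq_mul]; push_cast; rfl⟩
  split_ifs with h
  · have h1 : ∀ x : V.quotientAt I, Complex.exp (2 * Real.pi * Complex.I *
        (g (toRealSpace L (Quotient.out x)) : ℝ)) = 1 := fun x => (hone _).2 (h _)
    simp [h1]
  · push Not at h
    obtain ⟨l, hl⟩ := h
    -- Translating the summation variable by a class on which the character is `z ≠ 1` multiplies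
    -- the sum by `z`, so the sum is zero.
    set z := Complex.exp (2 * Real.pi * Complex.I * (g (toRealSpace L l) : ℝ)) with hz
    have hz1 : z ≠ 1 := fun h => hl ((hone _).1 h)
    have hshift : ∀ x : V.quotientAt I,
        Complex.exp (2 * Real.pi * Complex.I *
          (g (toRealSpace L (Quotient.out (x + (V.latticeAt I).mkQ l))) : ℝ)) =
        z * Complex.exp (2 * Real.pi * Complex.I * (g (toRealSpace L (Quotient.out x)) : ℝ)) := by
      intro x
      have h1 : Quotient.out (x + (V.latticeAt I).mkQ l) - (l + Quotient.out x) ∈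
          V.latticeAt I := by
        rw [← Submodule.Quotient.mk_eq_zero, Submodule.Quotient.mk_sub, Submodule.Quotient.mk_add]
        have e : ∀ x : V.quotientAt I, Submodule.Quotient.mk (Quotient.out x) = x :=
          fun x => Quotient.out_eq x
        rw [e, e, Submodule.mkQ_apply]
        abel
      have h2 := (hone _).2 (hlat _ h1)
      rw [hz, ← Complex.exp_add, ← mul_add, ← Complex.ofReal_add, ← map_add, ← map_add]
      rw [map_sub, map_sub, Complex.ofReal_sub, mul_sub, Complex.exp_sub,
        div_eq_one_iff_eq (Complex.exp_ne_zero _)] at h2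
      exact h2
    have hS := Equiv.sum_comp (Equiv.addRight ((V.latticeAt I).mkQ l))
      (fun x : V.quotientAt I =>
        Complex.exp (2 * Real.pi * Complex.I * (g (toRealSpace L (Quotient.out x)) : ℝ)))
    simp only [Equiv.coe_addRight, hshift] at hS
    rw [← Finset.mul_sum] at hS
    have : (z - 1) * ∑ x : V.quotientAt I,
        Complex.exp (2 * Real.pi * Complex.I * (g (toRealSpace L (Quotient.out x)) : ℝ)) = 0 := by
      rw [sub_mul, hS]
      ring
    exact (mul_eq_zero.1 this).resolve_left (sub_ne_zero.2 hz1)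

variable [Module.Free ℤ L] [Module.Finite ℤ L]

/-- The formal expansion, in the direction `v`, of the summand of the equivariant `T_y`-genus
given by `I` and `h ∈ H_I`. -/
def summandExpansion (y : ℂ) (v : RealSpace L) (I : Δ.facets) (h : V.quotientAt I.1)
    (g : Module.Dual ℝ (RealSpace L)) : ℂ :=
  ∏ i : I.1, tyExpansion y (0 < V.facetCoord I i v) (V.dualVec I i (toRealSpace L (Quotient.out h)))
    (-g (toRealSpace L (V.vec i)))

theorem expands_summand (y : ℂ) (v : RealSpace L) (I : Δ.facets) (h : V.quotientAt I.1) :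
    Expands (∏ i : I.1,
      ((1 + (y * (V.chi I.1 (V.dualVec I i) h)⁻¹) • tPow (-V.dualVec I i)) /
        (1 - (V.chi I.1 (V.dualVec I i) h)⁻¹ • tPow (-V.dualVec I i))))
      (V.summandExpansion y v I h) := by
  classical
  have hsmul : ∀ (c : ℂ) (u : Module.Dual ℝ (RealSpace L)), c • tPow u =
      algebraMap (AddMonoidAlgebra ℂ (Module.Dual ℝ (RealSpace L))) (CharacterField L)
        (AddMonoidAlgebra.single u c) := by
    intro c u
    have : AddMonoidAlgebra.single u c = c • AddMonoidAlgebra.single u (1 : ℂ) := by simp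
    rw [this, Algebra.smul_def, Algebra.smul_def, map_mul]
    rfl
  have hden : ∀ i : I.1, (1 - AddMonoidAlgebra.single (-V.dualVec I i)
      (V.chi I.1 (V.dualVec I i) h)⁻¹ :
        AddMonoidAlgebra ℂ (Module.Dual ℝ (RealSpace L))) ≠ 0 := by
    intro i h0
    have hu : V.dualVec I i ≠ 0 := by
      intro h1
      have h2 := V.dualVec_vec I i i
      rw [h1] at h2
      simp at h2
    have h3 := congrArg (fun a => a.coeff 0) h0
    simp [AddMonoidAlgebra.one_def, hu] at h3
  -- The denominators involve `t^{-u_i^I}`, so the coordinates dual to the shifts are the negated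
  -- evaluations at `v_i`.
  have hact := act_prod_coord (fun i : I.1 => -V.dualVec I i)
    (fun i : I.1 => -(LinearMap.applyₗ (toRealSpace L (V.vec i)) :
      Module.Dual ℝ (RealSpace L) →ₗ[ℝ] ℝ).toAddMonoidHom)
    (fun i j => by
      have := V.dualVec_vec I j i
      simp only [AddMonoidHom.neg_apply, LinearMap.toAddMonoidHom_coe, LinearMap.applyₗ_apply_apply,
        LinearMap.neg_apply, neg_neg, this, eq_comm])
    (fun i => tyExpansion y (0 < V.facetCoord I i v)
      (V.dualVec I i (toRealSpace L (Quotient.out h))))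
    (fun i => (V.chi I.1 (V.dualVec I i) h)⁻¹) (fun _ => 1)
    (fun i => y * (V.chi I.1 (V.dualVec I i) h)⁻¹)
    (fun i a => tyExpansion_sub y _ _ a)
  rw [prod_delta_eq_delta] at hact
  · refine ⟨_, _, Finset.prod_ne_zero_iff.2 fun i _ => hden i, ?_, hact⟩
    rw [map_prod, map_prod, ← Finset.prod_mul_distrib]
    refine Finset.prod_congr rfl fun i _ => ?_
    rw [hsmul, hsmul, map_add, map_sub, map_one]
    rw [show (AddMonoidAlgebra.single 0 1 : AddMonoidAlgebra ℂ (Module.Dual ℝ (RealSpace L))) = 1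
      from rfl, map_one, div_mul_cancel₀]
    rw [← map_one (algebraMap (AddMonoidAlgebra ℂ (Module.Dual ℝ (RealSpace L)))
      (CharacterField L)), ← map_sub]
    exact (map_ne_zero_iff _ (IsFractionRing.injective _ _)).2 (hden i)
  · intro g hg
    apply (V.basisAt I).ext
    intro i
    have := hg i
    rw [V.basisAt_apply]
    simpa using this

open Classical in
-- The phases multiply to `exp(2π√-1 ⟨g, v(h)⟩)`, since `∑ g(v_i) u_i^I = g`; the rest does not
-- depend on `h`, so orthogonality of characters applies.
theorem sum_summandExpansion (y : ℂ) (v : RealSpace L) (I : Δ.facets)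
    (g : Module.Dual ℝ (RealSpace L)) :
    ∑ h : V.quotientAt I.1, V.summandExpansion y v I h g =
      (if ∀ l, g (toRealSpace L l) ∈ Set.range ((↑) : ℤ → ℝ) then
        (Fintype.card (V.quotientAt I.1) : ℂ) else 0) *
      ∏ i ∈ I.1, (if 0 < V.facetCoord I i v then
        tyCoeff y (-g (toRealSpace L (V.vec i))) - (1 + y) + (1 + y)
        else tyCoeff y (-g (toRealSpace L (V.vec i))) - (1 + y)) := by
  have hneg : ∀ a : ℝ, -a ∈ Set.range ((↑) : ℤ → ℝ) ↔ a ∈ Set.range ((↑) : ℤ → ℝ) := by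
    intro a
    constructor
    · rintro ⟨k, hk⟩
      exact ⟨-k, by push_cast; linarith⟩
    · rintro ⟨k, hk⟩
      exact ⟨-k, by push_cast; linarith⟩
  by_cases hg : ∀ i ∈ I.1, g (toRealSpace L (V.vec i)) ∈ Set.range ((↑) : ℤ → ℝ)
  · rw [← V.sum_exp_quotientAt I.1 g hg, Finset.sum_mul]
    refine Finset.sum_congr rfl fun h _ => ?_
    rw [summandExpansion, ← Finset.prod_coe_sort I.1]
    have h1 : ∀ i : I.1, -g (toRealSpace L (V.vec i)) ∈ Set.range ((↑) : ℤ → ℝ) :=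
      fun i => (hneg _).2 (hg i i.2)
    simp only [tyExpansion, h1, if_true]
    rw [Finset.prod_mul_distrib, mul_comm, ← Complex.exp_sum]
    congr 2
    rw [Finset.sum_neg_distrib, ← Finset.mul_sum, ← mul_neg, ← Complex.ofReal_sum,
      ← Complex.ofReal_neg]
    congr 2
    conv_rhs => rw [← V.sum_facetCoord I (toRealSpace L (Quotient.out h))]
    rw [map_sum, ← Finset.sum_coe_sort I.1, ← Finset.sum_neg_distrib]
    refine Finset.sum_congr rfl fun i _ => ?_
    rw [map_smul, V.facetCoord_coe, smul_eq_mul]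
    ring
  · rw [if_neg, zero_mul]
    · push Not at hg
      obtain ⟨i, hi, hgi⟩ := hg
      refine Finset.sum_eq_zero fun h _ => ?_
      refine Finset.prod_eq_zero (Finset.mem_univ ⟨i, hi⟩) ?_
      rw [tyExpansion, if_neg]
      rwa [hneg]
    · intro h
      exact hg fun i _ => h _

/-- For `g ≠ 0`, the coefficient of the expansion of the `T_y`-genus at `g` vanishes. -/
theorem signSum_tyCoeff_eq_zero (hΔ : Δ.IsComplete) (y : ℂ) {v : RealSpace L}
    (hv : Δ.IsGeneric v) {g : Module.Dual ℝ (RealSpace L)} (hg : g ≠ 0) :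
    V.signSum (1 + y) (fun i => tyCoeff y (-g (toRealSpace L (V.vec i))) - (1 + y)) v = 0 := by
  classical
  -- By invariance the direction may be changed to one with `-g(v') < 0`, where every product
  -- contains a zero factor.
  obtain ⟨v', hv', hlt⟩ := exists_isGeneric_neg V (neg_ne_zero.2 hg)
  rw [V.signSum_eq_signSum hΔ V (1 + y) _ hv hv']
  refine Finset.sum_eq_zero fun I _ => ?_
  rw [mul_eq_zero]
  right
  by_contra hne
  rw [← ne_eq, Finset.prod_ne_zero_iff] at hne
  -- A nonzero factor forces `-g(v_i)` to have the same weak sign as `⟨u_i^I, v'⟩`, so every term of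
  -- `-g(v') = ∑ ⟨u_i^I, v'⟩ (-g(v_i))` is nonnegative.
  have : 0 ≤ (-g) v' := by
    rw [← V.sum_facetCoord I v', map_sum]
    refine Finset.sum_nonneg fun i hi => ?_
    rw [map_smul, smul_eq_mul, LinearMap.neg_apply]
    have h1 := hne i hi
    split_ifs at h1 with hpos
    · apply mul_nonneg hpos.le
      by_contra hlt
      push Not at hlt
      exact h1 (by simp [tyCoeff, hlt.ne, hlt.not_gt])
    · apply mul_nonneg_of_nonpos_of_nonpos (not_lt.1 hpos)
      by_contra hlt
      push Not at hlt
      exact h1 (by simp [tyCoeff, hlt.ne', hlt])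
  linarith

/-- For complete `Δ`, the equivariant `T_y`-genus is constant. -/
theorem equivariantTyGenus_eq (hΔ : Δ.IsComplete) (y : ℂ) {v : RealSpace L}
    (hv : Δ.IsGeneric v) :
    V.equivariantTyGenus y =
      algebraMap ℂ (CharacterField L) (V.signSum (1 + y) (fun _ => -y) v) := by
  classical
  apply Expands.eq_algebraMap
  have h := Expands.sum (Finset.univ : Finset Δ.facets) _ _ fun I _ =>
    (Expands.sum (Finset.univ : Finset (V.quotientAt I.1)) _ _ fun h _ =>
      V.expands_summand y v I h).smul
      ((Δ.w I.1 : ℂ) / (Fintype.card (V.quotientAt I.1) : ℂ))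
  unfold equivariantTyGenus
  convert h using 1
  ext g
  simp only [Finset.sum_apply, Pi.smul_apply, V.sum_summandExpansion, smul_eq_mul]
  by_cases hg : ∀ l, g (toRealSpace L l) ∈ Set.range ((↑) : ℤ → ℝ)
  · simp only [if_pos hg]
    have e : ∀ I : Δ.facets, ∀ c : ℂ,
        (Δ.w I.1 : ℂ) / (Fintype.card (V.quotientAt I.1) : ℂ) *
        ((Fintype.card (V.quotientAt I.1) : ℂ) * c) = (Δ.w I.1 : ℂ) * c := by
      intro I c
      have : (Fintype.card (V.quotientAt I.1) : ℂ) ≠ 0 := by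
        exact_mod_cast Fintype.card_ne_zero
      field_simp
    simp only [e]
    by_cases hg0 : g = 0
    · subst hg0
      simp [delta, tyCoeff, signSum]
    · have := V.signSum_tyCoeff_eq_zero hΔ y hv hg0
      rw [signSum] at this
      rw [this]
      simp [delta, hg0]
  · have hg0 : g ≠ 0 := by
      rintro rfl
      exact hg fun l => ⟨0, by simp⟩
    simp only [if_neg hg]
    simp [delta, hg0]

end EdgeVectors

end SimplicialMultiFan

end

/-! ### Vanishing by counting lattice points in half-open cones -/

noncomputable section

namespace SimplicialMultiFan

open ShiftAction Filter Topology

variable {ι : Type*} {L : Type*} [AddCommGroup L] {Δ : SimplicialMultiFan ι L}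

open Classical in
/-- The indicator function of the nonnegative integers if `s` holds, and of the positive integers
otherwise. -/
def rayIndicator (s : Prop) (a : ℝ) : ℂ :=
  if a ∈ Set.range ((↑) : ℤ → ℝ) ∧ (0 < a ∨ a = 0 ∧ s) then 1 else 0

open Classical in
-- The ray has generating series `1 / (1 - z)` if it contains the origin and `z / (1 - z)`
-- otherwise.
theorem rayIndicator_sub (s : Prop) (a : ℝ) :
    rayIndicator s a - 1 * rayIndicator s (a - 1) =
      (if s then 1 else 0) * delta a + (if s then 0 else 1) * delta (a - 1) := by
  by_cases ha : a ∈ Set.range ((↑) : ℤ → ℝ)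
  · obtain ⟨k, rfl⟩ := ha
    have e : (k : ℝ) - 1 = ((k - 1 : ℤ) : ℝ) := by push_cast; ring
    rw [e]
    simp only [rayIndicator, delta, Set.mem_range_self, true_and, Int.cast_eq_zero, Int.cast_pos]
    rcases lt_trichotomy k 0 with h | h | h
    · have h1 : ¬ k = 0 := by omega
      have h2 : ¬ 0 < k := by omega
      have h3 : ¬ k - 1 = 0 := by omega
      have h4 : ¬ 0 < k - 1 := by omega
      simp only [h1, h2, h3, h4]
      simp
    · subst h
      simp
    · by_cases h' : k = 1
      · subst h'
        by_cases hs : s <;> simp [hs]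
      · have h1 : ¬ k = 0 := by omega
        have h3 : ¬ k - 1 = 0 := by omega
        have h4 : 0 < k - 1 := by omega
        simp only [h1, h, h3, h4]
        simp
  · have ha1 : a - 1 ∉ Set.range ((↑) : ℤ → ℝ) := by
      rintro ⟨k, hk⟩
      exact ha ⟨k + 1, by push_cast; linarith⟩
    have h0 : a ≠ 0 := by
      rintro rfl
      exact ha ⟨0, by simp⟩
    have h1 : a - 1 ≠ 0 := by
      intro h
      exact ha1 ⟨0, by simp [h]⟩
    rw [rayIndicator, rayIndicator, if_neg (fun h => ha h.1), if_neg (fun h => ha1 h.1)]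
    simp [delta, h0, h1]

/-- This identifies the half-open cone as the set of points that a small shift along `v` takes into
the closed cone. -/
theorem eventually_nonneg_add_mul_iff (a : ℝ) {b : ℝ} (hb : b ≠ 0) :
    ∀ᶠ ε in 𝓝[>] (0 : ℝ), (0 ≤ a + ε * b ↔ 0 < a ∨ a = 0 ∧ 0 < b) := by
  have hcont : Tendsto (fun ε : ℝ => a + ε * b) (𝓝[>] 0) (𝓝 a) := by
    have : Continuous fun ε : ℝ => a + ε * b := by fun_prop
    have h := this.tendsto 0
    simp only [zero_mul, add_zero] at h
    exact h.mono_left nhdsWithin_le_nhds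
  rcases lt_trichotomy a 0 with ha | ha | ha
  · filter_upwards [hcont.eventually_lt_const ha] with ε hε
    exact iff_of_false (not_le.2 hε) (by rintro (h | h) <;> linarith)
  · subst ha
    filter_upwards [self_mem_nhdsWithin] with ε hε
    have hε' : 0 < ε := hε
    simp only [zero_add, lt_irrefl, true_and, false_or]
    rw [mul_nonneg_iff_of_pos_left hε']
    exact ⟨fun h => lt_of_le_of_ne h hb.symm, le_of_lt⟩
  · filter_upwards [hcont.eventually_const_lt ha] with ε hε
    exact iff_of_true hε.le (Or.inl ha)

/-- The line `m + ε v` meets each of the finitely many subspaces at most once, because `v` lies in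
none of them. -/
theorem eventually_isGeneric_add_smul (m : RealSpace L) {v : RealSpace L} (hv : Δ.IsGeneric v) :
    ∀ᶠ ε in 𝓝[>] (0 : ℝ), Δ.IsGeneric (m + ε • v) := by
  have h : ∀ J ∈ Δ.simplices, ∀ᶠ ε in 𝓝[>] (0 : ℝ),
      (J.card < Module.finrank ℤ L → m + ε • v ∉ Δ.coneSpan J) := by
    intro J hJ
    by_cases hc : J.card < Module.finrank ℤ L
    · have hsub : {ε : ℝ | m + ε • v ∈ Δ.coneSpan J}.Subsingleton := by
        intro ε hε δ hδ
        by_contra hne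
        have h1 : (ε - δ) • v ∈ Δ.coneSpan J := by
          have h2 := Submodule.sub_mem (Δ.coneSpan J) hε hδ
          rwa [add_sub_add_left_eq_sub, ← sub_smul] at h2
        exact hv J hJ hc ((Submodule.smul_mem_iff _ (sub_ne_zero.2 hne)).1 h1)
      have h3 : ∀ᶠ ε in 𝓝[>] (0 : ℝ), ε ∈ {ε : ℝ | m + ε • v ∈ Δ.coneSpan J}ᶜ := by
        have h4 := (hsub.finite.subset Set.sdiff_subset).isClosed.compl_mem_nhds
          (x := (0 : ℝ)) (s := {ε : ℝ | m + ε • v ∈ Δ.coneSpan J} \ {0}) (by simp)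
        filter_upwards [mem_nhdsWithin_of_mem_nhds h4, self_mem_nhdsWithin] with ε h5 h6 h7
        exact h5 ⟨h7, (ne_of_gt h6 : ε ≠ 0)⟩
      filter_upwards [h3] with ε hε _ using hε
    · filter_upwards with ε h
      exact absurd h hc
  exact (eventually_all_finset _).2 h

theorem toRealSpace_injective [Module.Free ℤ L] : Function.Injective (toRealSpace L) :=
  Module.Flat.tensorProduct_mk_injective ℤ L ℝ

namespace EdgeVectors

variable (V : Δ.EdgeVectors)

/-- If `c_1` is divisible by `N`, some `u ∈ L^*` satisfies `⟨u, v_i⟩ ≡ 1` modulo `N` for all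
`i`. -/
theorem exists_dual_of_chernClassDivisible [Fintype ι] {N : ℕ} (hc : V.ChernClassDivisible N) :
    ∃ u : Module.Dual ℤ L, ∀ i, ∃ a : ℤ, 1 = N * a + u (V.vec i) := by
  classical
  obtain ⟨x, hx⟩ := hc
  obtain ⟨x, rfl⟩ := Submodule.mkQ_surjective _ x
  rw [chernClass, ← map_nsmul, ← sub_eq_zero, ← map_sub, ← LinearMap.mem_ker,
    Submodule.ker_mkQ] at hx
  obtain ⟨u, hu⟩ := hx
  refine ⟨u, fun i => ?_⟩
  -- Evaluation at the `i`-th unit vector reads off the coefficient of `x_i`. It descends to the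
  -- face ring because a non-simplex is neither `∅` nor `{i}`, hence has a vertex other than `i`.
  set φ : MvPolynomial ι ℤ →+* ℤ := MvPolynomial.eval (fun j => if j = i then 1 else 0) with hφ
  have hker : ∀ p ∈ Δ.faceIdeal, φ p = 0 := by
    intro p hp
    rw [← RingHom.mem_ker]
    refine (Ideal.span_le (I := RingHom.ker φ)).2 ?_ hp
    rintro _ ⟨J, hJ, rfl⟩
    have : ∃ j ∈ J, j ≠ i := by
      by_contra! h
      rcases Finset.subset_singleton_iff.1 (fun j hj => Finset.mem_singleton.2 (h j hj)) with h' | h'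
      · exact hJ (h' ▸ Δ.empty_mem)
      · exact hJ (h' ▸ Δ.singleton_mem i)
    obtain ⟨j, hj, hji⟩ := this
    rw [SetLike.mem_coe, RingHom.mem_ker, map_prod]
    exact Finset.prod_eq_zero hj (by simp [hφ, hji])
  set ψ : Δ.FaceRing →+* ℤ := Ideal.Quotient.lift Δ.faceIdeal φ hker with hψ
  have hX : ∀ j, ψ (Δ.xClass j : Δ.FaceRing) = if j = i then 1 else 0 := by
    intro j
    rw [xClass, hψ, Ideal.Quotient.lift_mk, hφ, MvPolynomial.eval_X]
  have h1 := congrArg (fun z : Δ.equivariantH2 => ψ (z : Δ.FaceRing)) hu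
  simp only [dualToH2, equivariantChernClass, LinearMap.coe_mk, AddHom.coe_mk,
    AddSubgroupClass.coe_sub, Submodule.coe_sum, Submodule.coe_smul, map_sum, map_sub,
    map_zsmul, hX] at h1
  refine ⟨ψ (x : Δ.FaceRing), ?_⟩
  simp at h1
  linarith

variable [Module.Free ℤ L] [Module.Finite ℤ L]

theorem mem_latticeAt_iff (I : Δ.facets) (m : L) :
    m ∈ V.latticeAt I.1 ↔
      ∀ i ∈ I.1, V.facetCoord I i (toRealSpace L m) ∈ Set.range ((↑) : ℤ → ℝ) := by
  constructor
  · intro hm i hi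
    induction hm using Submodule.span_induction with
    | mem x hx =>
      obtain ⟨j, hj, rfl⟩ := hx
      by_cases hij : i = j
      · subst hij
        exact ⟨1, by simp [V.facetCoord_vec_self I hi]⟩
      · exact ⟨0, by simp [V.facetCoord_vec_of_ne I hj hij]⟩
    | zero => exact ⟨0, by simp⟩
    | add x y _ _ hx hy =>
      obtain ⟨a, ha⟩ := hx
      obtain ⟨b, hb⟩ := hy
      exact ⟨a + b, by rw [map_add, map_add, ← ha, ← hb]; push_cast; rfl⟩
    | smul c x _ hx =>
      obtain ⟨a, ha⟩ := hx
      exact ⟨c * a, by rw [map_smul, map_zsmul, ← ha, zsmul_eq_mul]; push_cast; rfl⟩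
  · intro h
    choose! k hk using h
    have : m = ∑ i ∈ I.1, k i • V.vec i := by
      apply toRealSpace_injective
      conv_lhs => rw [← V.sum_facetCoord I (toRealSpace L m)]
      rw [map_sum]
      refine Finset.sum_congr rfl fun i hi => ?_
      rw [← hk i hi, map_zsmul, Int.cast_smul_eq_zsmul]
    rw [this]
    exact Submodule.sum_mem _ fun i hi =>
      Submodule.smul_mem _ _ (Submodule.subset_span ⟨i, hi, rfl⟩)

/-- The indicator function of the lattice points of the half-open cone `C(I)` in the direction
`v`. -/
def coneIndicator (v : RealSpace L) (I : Δ.facets) (m : L) : ℂ :=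
  ∏ i : I.1, rayIndicator (0 < V.facetCoord I i v) (V.facetCoord I i (toRealSpace L m))

open Classical in
theorem act_coneIndicator (v : RealSpace L) (I : Δ.facets) :
    act (∏ i ∈ I.1, (1 - AddMonoidAlgebra.single (V.vec i) 1)) (V.coneIndicator v I) =
      act (∏ i ∈ I.1, (AddMonoidAlgebra.single 0 (if 0 < V.facetCoord I i v then 1 else 0) +
        AddMonoidAlgebra.single (V.vec i) (if 0 < V.facetCoord I i v then 0 else 1))) delta := by
  have h := act_prod_coord (fun i : I.1 => V.vec i)
    (fun i : I.1 => (V.facetCoord I i).toAddMonoidHom.comp (toRealSpace L).toAddMonoidHom)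
    (fun i j => by
      have := V.dualVec_vec I i j
      rw [← V.facetCoord_coe] at this
      simpa using this)
    (fun i => rayIndicator (0 < V.facetCoord I i v)) (fun _ => 1)
    (fun i => if 0 < V.facetCoord I i v then 1 else 0)
    (fun i => if 0 < V.facetCoord I i v then 0 else 1)
    (fun i a => rayIndicator_sub _ a)
  rw [prod_delta_eq_delta] at h
  · rw [← Finset.prod_coe_sort I.1, ← Finset.prod_coe_sort I.1]
    exact h
  · intro m hm
    apply toRealSpace_injective
    rw [← V.sum_facetCoord I (toRealSpace L m), map_zero]
    refine Finset.sum_eq_zero fun i hi => ?_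
    have : V.facetCoord I i (toRealSpace L m) = 0 := hm ⟨i, hi⟩
    rw [this, zero_smul]

open Classical in
/-- The half-open cones cover each point of `L_𝒱` with the same total weight. -/
theorem sum_coneIndicator (hΔ : Δ.IsComplete) (hP : V.IsGlobalType) {v : RealSpace L}
    (hv : Δ.IsGeneric v) (m : L) :
    ∑ I : Δ.facets, (Δ.w I.1 : ℂ) * V.coneIndicator v I m =
      if m ∈ V.lattice then (Δ.projDegree ∅ ((Δ.coneSpan ∅).mkQ v) : ℂ) else 0 := by
  have hind : ∀ I : Δ.facets, V.coneIndicator v I m =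
      if m ∈ V.lattice ∧ ∀ i ∈ I.1, (0 < V.facetCoord I i (toRealSpace L m) ∨
        V.facetCoord I i (toRealSpace L m) = 0 ∧ 0 < V.facetCoord I i v) then 1 else 0 := by
    intro I
    -- Here (P) enters: integrality of the `I`-coordinates becomes membership in one lattice common
    -- to all facets.
    rw [← hP I.1 I.2, V.mem_latticeAt_iff]
    split_ifs with h
    · exact Finset.prod_eq_one fun i _ => if_pos ⟨h.1 i i.2, h.2 i i.2⟩
    · rw [← forall₂_and] at h
      push Not at h
      obtain ⟨i, hi, h⟩ := h
      refine Finset.prod_eq_zero (Finset.mem_univ ⟨i, hi⟩) (if_neg fun h' => ?_)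
      have h1 := h h'.1
      rcases h'.2 with h2 | h2
      · exact absurd h2 (not_lt.2 h1.1)
      · exact absurd h2.2 (not_lt.2 (h1.2 h2.1))
  simp only [hind]
  split_ifs with hm
  · have h1 : ∀ᶠ ε in 𝓝[>] (0 : ℝ), ∀ I : Δ.facets, ∀ i ∈ I.1,
        (0 ≤ V.facetCoord I i (toRealSpace L m) + ε * V.facetCoord I i v ↔
          0 < V.facetCoord I i (toRealSpace L m) ∨
            V.facetCoord I i (toRealSpace L m) = 0 ∧ 0 < V.facetCoord I i v) := by
      rw [eventually_all]
      intro I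
      rw [eventually_all_finset]
      intro i hi
      exact eventually_nonneg_add_mul_iff _ (V.facetCoord_ne_zero I hv hi)
    -- For small `ε` the weighted sum at `m` is the degree at the generic vector `m + ε v`, which
    -- equals that at `v` by completeness.
    obtain ⟨ε, hε, hgen⟩ :=
      (h1.and (eventually_isGeneric_add_smul (toRealSpace L m) hv)).exists
    rw [← hΔ ∅ Δ.empty_mem _ _ (hgen.proj ∅) (hv.proj ∅), projDegree, Finset.sum_filter,
      Int.cast_sum, ← Finset.sum_coe_sort Δ.facets]
    refine Finset.sum_congr rfl fun I _ => ?_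
    have h2 : (∅ ⊆ I.1 ∧ (Δ.coneSpan ∅).mkQ (toRealSpace L m + ε • v) ∈ Δ.projCone ∅ I.1) ↔
        (m ∈ V.lattice ∧ ∀ i ∈ I.1, (0 < V.facetCoord I i (toRealSpace L m) ∨
          V.facetCoord I i (toRealSpace L m) = 0 ∧ 0 < V.facetCoord I i v)) := by
      rw [V.mkQ_mem_projCone_iff I (Finset.empty_subset _)]
      simp only [Finset.empty_subset, true_and, Finset.notMem_empty, not_false_eq_true,
        true_imp_iff, hm, map_add, map_smul, smul_eq_mul]
      exact forall₂_congr fun i hi => hε I i hi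
    simp only [h2]
    split_ifs <;> simp
  · exact Finset.sum_eq_zero fun I _ => by rw [if_neg fun h => hm h.1, mul_zero]

/-- The number `∑ w(I) ζ^{μ(I)}` vanishes if `ζ ≠ 1` and some character of `L` is equal to `ζ` on
all edge vectors. -/
theorem signSum_eq_zero [Fintype ι] (hn : 1 ≤ Module.finrank ℤ L) (hΔ : Δ.IsComplete)
    (hP : V.IsGlobalType) {ζ : ℂ} (hζ : ζ ≠ 1) (θ : Multiplicative L →* ℂ)
    (hθ : ∀ i, θ (Multiplicative.ofAdd (V.vec i)) = ζ) {v : RealSpace L} (hv : Δ.IsGeneric v) :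
    V.signSum (1 - ζ) (fun _ => ζ) v = 0 := by
  classical
  set D : ι → AddMonoidAlgebra ℂ L := fun i => 1 - AddMonoidAlgebra.single (V.vec i) 1 with hD
  set R : Δ.facets → AddMonoidAlgebra ℂ L := fun I =>
    (∏ i ∈ Finset.univ \ I.1, D i) * ∏ i ∈ I.1,
      (AddMonoidAlgebra.single 0 (if 0 < V.facetCoord I i v then 1 else 0) +
        AddMonoidAlgebra.single (V.vec i) (if 0 < V.facetCoord I i v then 0 else 1)) with hR
  have h1 : ∀ I : Δ.facets, act (∏ i, D i) (V.coneIndicator v I) = act (R I) delta := by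
    intro I
    rw [← Finset.prod_sdiff (Finset.subset_univ I.1), act_mul, V.act_coneIndicator, ← act_mul]
  have h2 : act (∏ i, D i) (∑ I : Δ.facets, (Δ.w I.1 : ℂ) • V.coneIndicator v I) = 0 := by
    obtain ⟨I, hI, hc⟩ := Δ.exists_card_eq
    have hI' : I ∈ Δ.facets := Finset.mem_filter.2 ⟨hI, hc⟩
    obtain ⟨i, hi⟩ : I.Nonempty := Finset.card_pos.1 (by omega)
    have hvi : V.vec i ∈ V.lattice := by
      rw [← hP I hI']
      exact Submodule.subset_span ⟨i, hi, rfl⟩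
    -- The total function is constant on `L_𝒱` and zero elsewhere, and `v_i ∈ L_𝒱`, so it is
    -- invariant under translation by `v_i`.
    have h3 : act (D i) (∑ I : Δ.facets, (Δ.w I.1 : ℂ) • V.coneIndicator v I) = 0 := by
      ext m
      have h4 := V.sum_coneIndicator hΔ hP hv m
      have h5 := V.sum_coneIndicator hΔ hP hv (m - V.vec i)
      rw [hD, act_one_sub_single]
      simp only [Finset.sum_apply, Pi.smul_apply, smul_eq_mul]
      rw [h4, h5, Submodule.sub_mem_iff_left _ hvi]
      simp
    rw [← Finset.prod_erase_mul _ _ (Finset.mem_univ i), act_mul, h3, map_zero]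
  have h3 : ∑ I : Δ.facets, (Δ.w I.1 : ℂ) • R I = 0 := by
    apply act_delta_injective
    rw [map_zero, LinearMap.zero_apply, ← h2, map_sum, map_sum, LinearMap.sum_apply]
    refine Finset.sum_congr rfl fun I _ => ?_
    rw [map_smul, map_smul, LinearMap.smul_apply, h1]
  -- Evaluate the group ring identity at the character `θ`: the factors with `i ∉ I` become `1 - ζ`,
  -- equally many for each facet.
  have h4 := congrArg (AddMonoidAlgebra.lift ℂ ℂ L θ) h3
  have hcard : ∀ I : Δ.facets, (Finset.univ \ I.1).card =
      Fintype.card ι - Module.finrank ℤ L := by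
    intro I
    rw [Finset.card_sdiff_of_subset (Finset.subset_univ _), Finset.card_univ,
      card_eq_finrank I.2]
  have h5 : ∀ I : Δ.facets, AddMonoidAlgebra.lift ℂ ℂ L θ (R I) =
      (1 - ζ) ^ (Fintype.card ι - Module.finrank ℤ L) *
        ∏ i ∈ I.1, (if 0 < V.facetCoord I i v then ζ + (1 - ζ) else ζ) := by
    intro I
    rw [hR, map_mul, map_prod, map_prod]
    congr 1
    · rw [← hcard I]
      apply Finset.prod_eq_pow_card
      intro i _
      simp [hD, AddMonoidAlgebra.lift_single, hθ]
    · refine Finset.prod_congr rfl fun i _ => ?_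
      rw [map_add, AddMonoidAlgebra.lift_single, AddMonoidAlgebra.lift_single, hθ]
      split_ifs <;> simp
  rw [map_sum, map_zero] at h4
  simp only [map_smul, h5, smul_eq_mul] at h4
  have h6 : (1 - ζ) ^ (Fintype.card ι - Module.finrank ℤ L) *
      V.signSum (1 - ζ) (fun _ => ζ) v = 0 := by
    rw [← h4, signSum, Finset.mul_sum]
    refine Finset.sum_congr rfl fun I _ => ?_
    ring
  exact (mul_eq_zero.1 h6).resolve_left (pow_ne_zero _ (sub_ne_zero.2 hζ.symm))

end EdgeVectors

end SimplicialMultiFan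

end

theorem mainTheorem8 {ι : Type*} [Fintype ι] {L : Type*} [AddCommGroup L] [Module.Free ℤ L]
    [Module.Finite ℤ L] (hn : 1 ≤ Module.finrank ℤ L)
    (Δ : SimplicialMultiFan ι L) (hΔ : Δ.IsComplete)
    (V : Δ.EdgeVectors) (hP : V.IsGlobalType)
    (N : ℕ) (hN : 1 < N) (hc : V.ChernClassDivisible N)
    (y : ℂ) (hy : (-y) ^ N = 1) (hy1 : -y ≠ 1) :
    Δ.HasTyGenus y 0 := by
  intro V'
  obtain ⟨v, hv⟩ := SimplicialMultiFan.exists_isGeneric V hn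
  obtain ⟨u, hu⟩ := V.exists_dual_of_chernClassDivisible hc
  have hy0 : -y ≠ 0 := by
    intro h
    rw [h, zero_pow (by omega)] at hy
    exact zero_ne_one hy
  have hy' : (Units.mk0 (-y) hy0) ^ N = 1 := by
    ext
    simpa using hy
  -- The character is `l ↦ (-y)^⟨u, l⟩`; it is `-y` on each `v_i` because `⟨u, v_i⟩ ≡ 1` modulo `N`
  -- and `(-y)^N = 1`.
  have hθ : ∀ i, ((Units.coeHom ℂ).comp ((zpowersHom ℂˣ (Units.mk0 (-y) hy0)).comp
      u.toAddMonoidHom.toMultiplicative)) (Multiplicative.ofAdd (V.vec i)) = -y := by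
    intro i
    obtain ⟨a, ha⟩ := hu i
    have h1 : (Units.mk0 (-y) hy0) ^ u (V.vec i) = Units.mk0 (-y) hy0 := by
      have h2 : u (V.vec i) = 1 - N * a := by omega
      rw [h2, zpow_sub, zpow_one, zpow_mul, zpow_natCast, hy', one_zpow, inv_one, mul_one]
    have h3 := congrArg (Units.val) h1
    simpa using h3
  have h0 := V.signSum_eq_zero hn hΔ hP hy1 _ hθ hv
  -- The genus of `V'` is moved to the edge vectors `V` satisfying (P), as the sum depends on
  -- neither choice.
  rw [V'.equivariantTyGenus_eq hΔ y hv, V'.signSum_eq_signSum hΔ V _ _ hv hv]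
  rw [sub_neg_eq_add] at h0
  rw [h0]
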